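/- **Lemma 3.2 (Asymptotic variance).** Let $\pi$ be a probability measure on a measurable space $K$, let $L^2(\pi)$ be the real Hilbert space with $\langle f,g\rangle=\int fg\,d\pi$, and put $\bar f=\int f\,d\pi$ and $H^0=\{f\in L^2(\pi):\bar f=0\}$. Sums of unbounded operators carry the intersection of the domains. A Markov semigroup on $L^2(\pi)$ means a strongly continuous, positivity preserving semigroup of bounded operators $T_t$ with $T_t1=1$ and $\int T_tf\,d\pi=\int f\,d\pi$ for all $f\in L^2(\pi)$. Let $X_0$ and $X$ be jointly measurable stationary Markov processes in continuous time $t\ge 0$ with state space $K$ and one-dimensional marginals $\pi$, whose transition semigroups on $L^2(\pi)$ are Markov semigroups with generators $\mathcal L_0$ and $\mathcal L=\mathcal L_0+\mathcal S+\mathcal A$, respectively. Assume: 1. $X_0$ is reversible, i.e. its transition operators are self-adjoint on $L^2(\pi)$. 2. $D(\mathcal L_0)\subset D(\mathcal S)$, the operator $\mathcal L_0+\mathcal S$ is the generator of a Markov semigroup on $L^2(\pi)$, and $\langle f,\mathcal S g\rangle=\langle \mathcal S f,g\rangle$ and $\langle f,\mathcal S f\rangle\le 0$ for all $f,g\in D(\mathcal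 S)$. 3. $D(\mathcal L_0+\mathcal S)\subset D(\mathcal A)$, and $\langle f,\mathcal A g\rangle=-\langle \mathcal A f,g\rangle$ for all $f,g\in D(\mathcal A)$. 4. $\mathcal L_0$ and $\mathcal L$, restricted to $H^0$, have bounded inverses on $H^0$. 5. The operator $(-\mathcal L_0-\mathcal S)^{-1/2}\,\mathcal A\,(-\mathcal L_0-\mathcal S)^{-1/2}$ on $H^0$ is bounded, where $(-\mathcal L_0-\mathcal S)^{-1/2}$ is the positive square root of the bounded inverse of $-\mathcal L_0-\mathcal S$ on $H^0$. For $f\in L^2(\pi)$ let $S^0_t(f)=\int_0^t f(X_0(r))\,dr$ and $S_t(f)=\int_0^t f(X(r))\,dr$. Then for every $f\in L^2(\pi)$ the asymptotic variances of $S^0_t(f)/t$ and $S_t(f)/t$ exist and are given by $$\sigma_0^2(f):=\lim_{t\to\infty}\tfrac1t\operatorname{Var}(S^0_t(f))=2\,\langle f-\bar f,(-\mathcal L_0)^{-1}(f-\bar f)\rangle,$$ $$\sigma^2(f):=\lim_{t\to\infty}\tfrac1t\operatorname{Var}(S_t(f))=2\,\langle f-\bar f,(-\mathcal L)^{-1}(f-\bar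 f)\rangle,$$ and $$\sigma^2(f)\le\sigma_0^2(f).$$ -/

import Mathlib

open MeasureTheory Filter Topology
open scoped NNReal

/-- The real Hilbert space `L²(π)`. -/
abbrev L2 {K : Type*} [MeasurableSpace K] (π : Measure K) : Type _ := Lp ℝ 2 π

/-- The mean-zero subspace of `L²(π)`. -/
def H0 {K : Type*} [MeasurableSpace K] (π : Measure K) [IsProbabilityMeasure π] :
    Submodule ℝ (L2 π) where
  carrier := {f | ∫ x, f x ∂π = 0}
  zero_mem' := by
    change ∫ x, (0 : L2 π) x ∂π = 0
    rw [integral_congr_ae (Lp.coeFn_zero ℝ 2 π)]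
    simp
  add_mem' := by
    intro f g hf hg
    change ∫ x, (f + g : L2 π) x ∂π = 0
    change ∫ x, f x ∂π = 0 at hf
    change ∫ x, g x ∂π = 0 at hg
    rw [integral_congr_ae (Lp.coeFn_add f g)]
    simp only [Pi.add_apply]
    rw [integral_add ((Lp.memLp f).integrable (by norm_num))
      ((Lp.memLp g).integrable (by norm_num)), hf, hg, add_zero]
  smul_mem' := by
    intro c f hf
    change ∫ x, (c • f : L2 π) x ∂π = 0
    change ∫ x, f x ∂π = 0 at hf
    rw [integral_congr_ae (Lp.coeFn_smul c f)]
    simp only [Pi.smul_apply]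
    rw [integral_smul, hf, smul_zero]

/-- The centred observable `f - ∫ f dπ`, as an element of the mean-zero subspace. -/
noncomputable def center {K : Type*} [MeasurableSpace K] (π : Measure K) [IsProbabilityMeasure π]
    (f : L2 π) : H0 π :=
  ⟨f - Lp.const 2 π (∫ x, f x ∂π), by
    change ∫ x, (f - Lp.const 2 π (∫ x, f x ∂π) : L2 π) x ∂π = 0
    rw [integral_congr_ae (Lp.coeFn_sub f (Lp.const 2 π (∫ x, f x ∂π)))]
    simp only [Pi.sub_apply]
    rw [integral_sub ((Lp.memLp f).integrable (by norm_num))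
      ((Lp.memLp _).integrable (by norm_num)),
      integral_congr_ae (Lp.coeFn_const 2 π (∫ x, f x ∂π))]
    simp⟩

/-- `T` is a strongly continuous Markov semigroup on `L²(π)` with invariant measure `π`. -/
structure IsMarkovSemigroup {K : Type*} [MeasurableSpace K] (π : Measure K)
    [IsProbabilityMeasure π] (T : ℝ≥0 → L2 π →L[ℝ] L2 π) : Prop where
  zero : T 0 = ContinuousLinearMap.id ℝ (L2 π)
  add : ∀ s t, T (s + t) = (T s).comp (T t)
  continuous : ∀ f, Continuous fun t => T t f
  nonneg : ∀ t f, 0 ≤ f → 0 ≤ T t f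
  one : ∀ t, T t (Lp.const 2 π 1) = Lp.const 2 π 1
  invariant : ∀ t f, ∫ x, T t f x ∂π = ∫ x, f x ∂π

/-- The unbounded operator `L` is the infinitesimal generator of `T`: its domain consists exactly
of those `f` for which `(T_t f - f) / t` converges as `t ↓ 0`, and `L f` is the limit. -/
def IsGenerator {K : Type*} [MeasurableSpace K] {π : Measure K}
    (T : ℝ≥0 → L2 π →L[ℝ] L2 π) (L : L2 π →ₗ.[ℝ] L2 π) : Prop :=
  ∀ f g : L2 π, (f, g) ∈ L.graph ↔
    Tendsto (fun t : ℝ≥0 => (t : ℝ)⁻¹ • (T t f - f)) (𝓝[>] 0) (𝓝 g)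

/-- `X` is a (jointly measurable) stationary Markov process under `P`, with one-dimensional
marginals `π` and transition semigroup `T`. -/
structure IsStationaryMarkovProcess {K Ω : Type*} [MeasurableSpace K] [MeasurableSpace Ω]
    (π : Measure K) (T : ℝ≥0 → L2 π →L[ℝ] L2 π) (P : Measure Ω) (X : ℝ≥0 → Ω → K) : Prop where
  measurable : Measurable fun p : ℝ≥0 × Ω => X p.1 p.2
  law : ∀ t, P.map (X t) = π
  markov : ∀ (s t : ℝ≥0) (f : L2 π),
    P[fun ω => f (X (s + t) ω) | ⨆ r : Set.Iic s, MeasurableSpace.comap (X r) inferInstance]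
      =ᵐ[P] fun ω => T t f (X s ω)

/-- The additive functional `S_t(f) = ∫₀ᵗ f(X(r)) dr`. -/
noncomputable def timeIntegral {K Ω : Type*} (X : ℝ≥0 → Ω → K) (f : K → ℝ) (t : ℝ) (ω : Ω) : ℝ :=
  ∫ r in (0 : ℝ)..t, f (X r.toNNReal ω)

/-- `v` is the asymptotic variance of the time average `S_t(f) / t`:
`t Var(S_t(f) / t) = Var(S_t(f)) / t` tends to `v` as `t → ∞`. -/
def HasAsymptoticVariance {K Ω : Type*} [MeasurableSpace Ω] (P : Measure Ω) (X : ℝ≥0 → Ω → K)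
    (f : K → ℝ) (v : ℝ) : Prop :=
  Tendsto (fun t : ℝ => ProbabilityTheory.variance (timeIntegral X f t) P / t) atTop (𝓝 v)

/-- The bounded operator `G` on the mean-zero subspace is the inverse of the restriction of the
unbounded operator `M` to that subspace. -/
def IsInverseOnH0 {K : Type*} [MeasurableSpace K] {π : Measure K} [IsProbabilityMeasure π]
    (M : L2 π →ₗ.[ℝ] L2 π) (G : H0 π →L[ℝ] H0 π) : Prop :=
  ∀ f g : H0 π, ((f : L2 π), (g : L2 π)) ∈ M.graph ↔ G g = f

/-- `Q = M^{-1/2}` on the mean-zero subspace: the positive square root of the inverse of `M`. -/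
def IsInverseSqrtOnH0 {K : Type*} [MeasurableSpace K] {π : Measure K} [IsProbabilityMeasure π]
    (M : L2 π →ₗ.[ℝ] L2 π) (Q : H0 π →L[ℝ] H0 π) : Prop :=
  Q.IsPositive ∧ IsInverseOnH0 M (Q.comp Q)

/-- The operator `Q A Q` on the mean-zero subspace, with its natural domain
`{g | Q g ∈ D(A)}`, is bounded. -/
def IsBoundedConjugate {K : Type*} [MeasurableSpace K] {π : Measure K} [IsProbabilityMeasure π]
    (Q : H0 π →L[ℝ] H0 π) (A : L2 π →ₗ.[ℝ] L2 π) : Prop :=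
  ∃ C : ℝ, ∀ g a : H0 π, ((Q g : L2 π), (a : L2 π)) ∈ A.graph → ‖Q a‖ ≤ C * ‖g‖

/-- The quantity `2 ⟨f - f̄, G (f - f̄)⟩`, to be used with `G = (-L)⁻¹`. -/
noncomputable def sigmaSq {K : Type*} [MeasurableSpace K] {π : Measure K} [IsProbabilityMeasure π]
    (G : H0 π →L[ℝ] H0 π) (f : L2 π) : ℝ :=
  2 * inner ℝ (center π f) (G (center π f))

/-!
The two-time correlations of a stationary Markov process are read off its semigroup:
`E[w(X_s) f(X_{s+u})] = ⟨w, T_u f⟩` (`IsStationaryMarkovProcess.integral_mul_add`). Hence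
`Var S_t(f) = ∫₀ᵗ ∫₀ᵗ ⟨w, T_{|r-s|} w⟩ ds dr` with `w = f - f̄`
(`IsStationaryMarkovProcess.variance_timeIntegral`). As `w = -L G w` and `G w = -L G G w`, the
integrals telescope and give `Var S_t(f) = 2 t ⟨w, G w⟩ - 2 ⟨w, k - T_t k⟩` with `k = G G w`. The
last term is bounded because the transition operators are contractions, so dividing by `t` yields
the limit (`IsStationaryMarkovProcess.hasAsymptoticVariance`).

For the comparison, put `h = G w`, so that `-(L₀ + S + A) h = w`. Antisymmetry gives `⟨h, A h⟩ = 0`,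
and `⟨h, S h⟩ ≤ 0`, so `⟨h, -L₀ h⟩ ≤ ⟨h, w⟩`. Let `h₀ = G₀ w`, that is `-L₀ h₀ = w`. The operator `L₀` is
symmetric by reversibility and dissipative, so
`0 ≤ ⟨h₀ - h, -L₀ (h₀ - h)⟩ = ⟨h₀, w⟩ - 2 ⟨h, w⟩ + ⟨h, -L₀ h⟩ ≤ ⟨h₀, w⟩ - ⟨h, w⟩`,
which is the claim. The vector `h` may be inserted into the quadratic form of `-L₀` because the
domain of a sum of operators is the intersection of the domains.
-/

/-! ### Second moments of time integrals -/

/-- Fubini for the second moment of a time integral, under a uniform bound on the one-time second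
moments. Integrability of the individual paths is not assumed: where a path is not integrable,
both sides of `(∫ Z)² = ∫ Z(r) Z(s) d(r, s)` are `0`. -/
theorem integral_sq_integral {Ω : Type*} [MeasurableSpace Ω] {P : Measure Ω} [IsFiniteMeasure P]
    {ν : Measure ℝ} [IsFiniteMeasure ν] {Z : ℝ → Ω → ℝ}
    (hZ : Measurable (Function.uncurry Z)) {V : ℝ}
    (hsq : ∀ r, Integrable (fun ω => Z r ω ^ 2) P) (hV : ∀ r, ∫ ω, Z r ω ^ 2 ∂P ≤ V) :
    ∫ ω, (∫ r, Z r ω ∂ν) ^ 2 ∂P = ∫ r, ∫ s, ∫ ω, Z r ω * Z s ω ∂P ∂ν ∂ν := by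
  have hm : Measurable fun p : (ℝ × ℝ) × Ω => Z p.1.1 p.2 * Z p.1.2 p.2 :=
    (hZ.comp (by fun_prop : Measurable fun p : (ℝ × ℝ) × Ω => (p.1.1, p.2))).mul
      (hZ.comp (by fun_prop : Measurable fun p : (ℝ × ℝ) × Ω => (p.1.2, p.2)))
  -- Cauchy-Schwarz in the form `|ab| ≤ (a² + b²) / 2` bounds the mixed moments by `V`.
  have hbd : ∀ r s ω, ‖Z r ω * Z s ω‖ ≤ (Z r ω ^ 2 + Z s ω ^ 2) / 2 := by
    intro r s ω
    rw [Real.norm_eq_abs, abs_le]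
    constructor <;> nlinarith [sq_nonneg (Z r ω + Z s ω), sq_nonneg (Z r ω - Z s ω)]
  have hdom : ∀ r s, Integrable (fun ω => (Z r ω ^ 2 + Z s ω ^ 2) / 2) P :=
    fun r s => ((hsq r).add (hsq s)).div_const 2
  have hrs : ∀ r s, Integrable (fun ω => Z r ω * Z s ω) P := fun r s =>
    (hdom r s).mono' (hm.comp (measurable_prodMk_left (x := (r, s)))).aestronglyMeasurable
      (ae_of_all _ (hbd r s))
  have hint : Integrable (fun p : (ℝ × ℝ) × Ω => Z p.1.1 p.2 * Z p.1.2 p.2)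
      ((ν.prod ν).prod P) := by
    rw [integrable_prod_iff hm.aestronglyMeasurable]
    refine ⟨ae_of_all _ fun p => hrs p.1 p.2, Integrable.of_bound (C := V) ?_ ?_⟩
    · exact hm.norm.stronglyMeasurable.integral_prod_right.aestronglyMeasurable
    · refine ae_of_all _ fun p => ?_
      rw [Real.norm_of_nonneg (integral_nonneg fun _ => norm_nonneg _)]
      calc ∫ ω, ‖Z p.1 ω * Z p.2 ω‖ ∂P ≤ ∫ ω, (Z p.1 ω ^ 2 + Z p.2 ω ^ 2) / 2 ∂P :=
            integral_mono (hrs p.1 p.2).norm (hdom p.1 p.2) (hbd p.1 p.2)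
        _ = (∫ ω, Z p.1 ω ^ 2 ∂P + ∫ ω, Z p.2 ω ^ 2 ∂P) / 2 := by
            rw [integral_div, integral_add (hsq _) (hsq _)]
        _ ≤ V := by linarith [hV p.1, hV p.2]
  calc ∫ ω, (∫ r, Z r ω ∂ν) ^ 2 ∂P
      = ∫ ω, ∫ p : ℝ × ℝ, Z p.1 ω * Z p.2 ω ∂(ν.prod ν) ∂P := by
        refine integral_congr_ae (ae_of_all _ fun ω => ?_)
        simp only
        rw [sq, integral_prod_mul (fun r => Z r ω) (fun r => Z r ω)]
    _ = ∫ p : ℝ × ℝ, ∫ ω, Z p.1 ω * Z p.2 ω ∂P ∂(ν.prod ν) :=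
        (integral_integral_swap hint).symm
    _ = ∫ r, ∫ s, ∫ ω, Z r ω * Z s ω ∂P ∂ν ∂ν := integral_prod _ hint.integral_prod_left

theorem integral_mul_eq_of_condExp_ae_eq {Ω : Type*} {m m₀ : MeasurableSpace Ω}
    {P : Measure[m₀] Ω} [IsFiniteMeasure P] (hm : m ≤ m₀) {w f g : Ω → ℝ}
    (hw : StronglyMeasurable[m] w) (hwf : Integrable (w * f) P) (hf : Integrable f P)
    (hg : P[f | m] =ᵐ[P] g) : ∫ ω, w ω * f ω ∂P = ∫ ω, w ω * g ω ∂P := by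
  refine (integral_condExp hm (f := w * f)).symm.trans (integral_congr_ae ?_)
  filter_upwards [condExp_mul_of_stronglyMeasurable_left hw hwf hf, hg] with ω h1 h2
  rw [h1, Pi.mul_apply, h2]

/-- A stationary kernel on the square `[0, t]²` integrates to twice the integral of its primitive:
for fixed `r` the inner integral is `C r + C (t - r)`. -/
theorem integral_integral_abs_sub {c C : ℝ → ℝ} (hc : Continuous c)
    (hC : ∀ r, 0 ≤ r → ∫ u in (0 : ℝ)..r, c u = C r) {t : ℝ} (ht : 0 ≤ t) :
    ∫ r in (0 : ℝ)..t, ∫ s in (0 : ℝ)..t, c |r - s| = 2 * ∫ r in (0 : ℝ)..t, C r := by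
  have hcont : Continuous fun r => ∫ u in (0 : ℝ)..r, c u :=
    intervalIntegral.continuous_primitive (fun a b => hc.intervalIntegrable a b) 0
  have inner : ∀ r ∈ Set.uIcc 0 t, ∫ s in (0 : ℝ)..t, c |r - s| =
      (∫ u in (0 : ℝ)..r, c u) + ∫ u in (0 : ℝ)..(t - r), c u := by
    intro r hr
    rw [Set.uIcc_of_le ht] at hr
    have hi : ∀ a b, IntervalIntegrable (fun s => c |r - s|) volume a b := fun a b =>
      (hc.comp (by fun_prop : Continuous fun s : ℝ => |r - s|)).intervalIntegrable a b
    rw [← intervalIntegral.integral_add_adjacent_intervals (hi 0 r) (hi r t)]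
    congr 1
    · rw [intervalIntegral.integral_congr (g := fun s => c (r - s)),
        intervalIntegral.integral_comp_sub_left (fun u => c u)]
      · simp
      · intro s hs
        rw [Set.uIcc_of_le hr.1] at hs
        simp only
        rw [abs_of_nonneg (by linarith [hs.2])]
    · rw [intervalIntegral.integral_congr (g := fun s => c (s - r)),
        intervalIntegral.integral_comp_sub_right (fun u => c u)]
      · simp
      · intro s hs
        rw [Set.uIcc_of_le hr.2] at hs
        simp only
        rw [abs_of_nonpos (by linarith [hs.1]), neg_sub]
  have hcont' : Continuous fun r => ∫ u in (0 : ℝ)..(t - r), c u :=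
    hcont.comp (by fun_prop : Continuous fun r : ℝ => t - r)
  rw [intervalIntegral.integral_congr inner, intervalIntegral.integral_add
    (hcont.intervalIntegrable _ _) (hcont'.intervalIntegrable _ _),
    intervalIntegral.integral_comp_sub_left (fun r => ∫ u in (0 : ℝ)..r, c u)]
  simp only [sub_self, sub_zero]
  rw [← two_mul]
  congr 1
  refine intervalIntegral.integral_congr fun r hr => ?_
  rw [Set.uIcc_of_le ht] at hr
  exact hC r hr.1

/-! ### Weak identities for semigroups and their generators -/

section Semigroup

variable {K : Type*} [MeasurableSpace K] {π : Measure K}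
  {T : ℝ≥0 → L2 π →L[ℝ] L2 π} {L : L2 π →ₗ.[ℝ] L2 π}

theorem IsGenerator.tendsto_inner (hL : IsGenerator T L) {g l : L2 π} (hg : (g, l) ∈ L.graph)
    (w : L2 π) :
    Tendsto (fun t : ℝ≥0 => (t : ℝ)⁻¹ * (inner ℝ w (T t g) - inner ℝ w g)) (𝓝[>] 0)
      (𝓝 (inner ℝ w l)) := by
  have := (tendsto_const_nhds (x := w)).inner (𝕜 := ℝ) ((hL g l).1 hg)
  simpa only [inner_smul_right, inner_sub_right] using this

/-- The generator of a semigroup of symmetric operators is symmetric. -/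
theorem IsGenerator.inner_symm (hsymm : ∀ (t : ℝ≥0) (f g : L2 π),
      inner ℝ (T t f) g = inner ℝ f (T t g)) (hL : IsGenerator T L)
    {f l g m : L2 π} (hf : (f, l) ∈ L.graph) (hg : (g, m) ∈ L.graph) :
    (inner ℝ g l : ℝ) = inner ℝ f m := by
  refine tendsto_nhds_unique (hL.tendsto_inner hf g) ((hL.tendsto_inner hg f).congr fun t => ?_)
  rw [← hsymm, real_inner_comm g, real_inner_comm g]

variable [IsProbabilityMeasure π]

/-- The forward right derivative `d/du ⟨w, T_u g⟩ = ⟨w, T_u L g⟩`. The right derivative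
suffices for the fundamental theorem of calculus, and unlike the two-sided one it does not require
local boundedness of the semigroup. -/
theorem IsGenerator.hasDerivWithinAt_inner (hT : IsMarkovSemigroup π T) (hL : IsGenerator T L)
    {g l : L2 π} (hg : (g, l) ∈ L.graph) (w : L2 π) {u : ℝ} (hu : 0 ≤ u) :
    HasDerivWithinAt (fun v : ℝ => inner ℝ w (T v.toNNReal g))
      (inner ℝ w (T u.toNNReal l)) (Set.Ioi u) u := by
  rw [hasDerivWithinAt_iff_tendsto_slope' (by simp)]
  have h1 : Tendsto (fun t : ℝ≥0 => T u.toNNReal ((t : ℝ)⁻¹ • (T t g - g))) (𝓝[>] 0)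
      (𝓝 (T u.toNNReal l)) := ((T u.toNNReal).continuous.tendsto l).comp ((hL g l).1 hg)
  have h2 : Tendsto (fun v : ℝ => (v - u).toNNReal) (𝓝[>] u) (𝓝[>] 0) := by
    refine tendsto_nhdsWithin_iff.2 ⟨?_, ?_⟩
    · have : Continuous fun v : ℝ => (v - u).toNNReal := by fun_prop
      simpa using (this.tendsto u).mono_left nhdsWithin_le_nhds
    · filter_upwards [self_mem_nhdsWithin] with v hv
      simpa using hv
  refine ((tendsto_const_nhds (x := w)).inner (𝕜 := ℝ) (h1.comp h2)).congr' ?_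
  filter_upwards [self_mem_nhdsWithin] with v hv
  have hv' : u < v := hv
  have h3 : v.toNNReal = u.toNNReal + (v - u).toNNReal := by
    rw [← Real.toNNReal_add hu (by linarith)]; congr 1; ring
  simp only [Function.comp_apply, slope_def_field]
  rw [h3, hT.add, ContinuousLinearMap.comp_apply, map_smul, map_sub, inner_smul_right,
    inner_sub_right, Real.coe_toNNReal _ (by linarith : 0 ≤ v - u)]
  field_simp

theorem IsMarkovSemigroup.continuous_inner (hT : IsMarkovSemigroup π T) (w g : L2 π) :
    Continuous fun v : ℝ => (inner ℝ w (T v.toNNReal g) : ℝ) :=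
  continuous_const.inner ((hT.continuous g).comp continuous_real_toNNReal)

/-- Weak form of `∫₀ʳ T_u (L g) du = T_r g - g`. -/
theorem IsGenerator.integral_inner (hT : IsMarkovSemigroup π T) (hL : IsGenerator T L)
    {g l : L2 π} (hg : (g, l) ∈ L.graph) (w : L2 π) {r : ℝ} (hr : 0 ≤ r) :
    ∫ u in (0 : ℝ)..r, inner ℝ w (T u.toNNReal l) =
      inner ℝ w (T r.toNNReal g) - inner ℝ w g := by
  have := intervalIntegral.integral_eq_sub_of_hasDeriv_right_of_le hr
    (hT.continuous_inner w g).continuousOn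
    (fun u hu => hL.hasDerivWithinAt_inner hT hg w hu.1.le)
    ((hT.continuous_inner w l).intervalIntegrable 0 r)
  simpa [hT.zero] using this

theorem mem_graph_of_isInverseOnH0_neg {G : H0 π →L[ℝ] H0 π} (hG : IsInverseOnH0 (-L) G)
    (g : H0 π) : ((G g : L2 π), -(g : L2 π)) ∈ L.graph := by
  have := (hG (G g) g).2 rfl
  rw [LinearPMap.mem_graph_iff] at this ⊢
  obtain ⟨y, hy, hy'⟩ := this
  refine ⟨⟨y, y.2⟩, hy, ?_⟩
  change -(L ⟨y, y.2⟩) = (g : L2 π) at hy'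
  change L ⟨y, y.2⟩ = -(g : L2 π)
  rw [← hy', neg_neg]

theorem coeFn_center_ae_eq (f : L2 π) :
    (fun x => (center π f : L2 π) x) =ᵐ[π] fun x => f x - ∫ y, f y ∂π := by
  have h1 := Lp.coeFn_sub f (Lp.const 2 π (∫ y, f y ∂π))
  filter_upwards [h1, Lp.coeFn_const (p := 2) (μ := π) (∫ y, f y ∂π)] with x hx hx'
  change (f - Lp.const 2 π (∫ y, f y ∂π) : L2 π) x = _
  rw [hx, Pi.sub_apply, hx']
  rfl

end Semigroup

/-! ### Covariances and asymptotic variance of a stationary Markov process -/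

section StationaryProcess

variable {K Ω : Type*} [MeasurableSpace K] [MeasurableSpace Ω] {π : Measure K} {P : Measure Ω}
  {T : ℝ≥0 → L2 π →L[ℝ] L2 π} {L : L2 π →ₗ.[ℝ] L2 π} {X : ℝ≥0 → Ω → K}

namespace IsStationaryMarkovProcess

theorem measurePreserving (hX : IsStationaryMarkovProcess π T P X) (t : ℝ≥0) :
    MeasurePreserving (X t) P π :=
  ⟨hX.measurable.comp measurable_prodMk_left, hX.law t⟩

theorem memLp_comp (hX : IsStationaryMarkovProcess π T P X) (t : ℝ≥0) (f : L2 π) :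
    MemLp (fun ω => f (X t ω)) 2 P :=
  (Lp.memLp f).comp_measurePreserving (hX.measurePreserving t)

theorem integral_comp (hX : IsStationaryMarkovProcess π T P X) (t : ℝ≥0) {φ : K → ℝ}
    (hφ : AEStronglyMeasurable φ π) : ∫ ω, φ (X t ω) ∂P = ∫ x, φ x ∂π := by
  have h := hX.measurePreserving t
  rw [← hX.law t, integral_map h.aemeasurable (by rwa [hX.law t])]

theorem integral_sq (hX : IsStationaryMarkovProcess π T P X) (t : ℝ≥0) (f : L2 π) :
    ∫ ω, f (X t ω) ^ 2 ∂P = ‖f‖ ^ 2 := by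
  rw [hX.integral_comp t (φ := fun x => f x ^ 2) ((Lp.aestronglyMeasurable f).pow 2),
    ← real_inner_self_eq_norm_sq, L2.inner_def]
  simp [sq]

variable [IsProbabilityMeasure P]

/-- Stationary two-time correlations are matrix elements of the transition semigroup. -/
theorem integral_mul_add (hX : IsStationaryMarkovProcess π T P X) (s u : ℝ≥0) (w f : L2 π) :
    ∫ ω, w (X s ω) * f (X (s + u) ω) ∂P = inner ℝ w (T u f) := by
  have hle : (⨆ r : Set.Iic s, MeasurableSpace.comap (X r) inferInstance) ≤
      ‹MeasurableSpace Ω› :=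
    iSup_le fun r => (hX.measurePreserving r).measurable.comap_le
  have hw : StronglyMeasurable[⨆ r : Set.Iic s, MeasurableSpace.comap (X r) inferInstance]
      fun ω => w (X s ω) := by
    refine (Lp.stronglyMeasurable w).comp_measurable ?_
    refine Measurable.mono (comap_measurable (X s)) ?_ le_rfl
    exact le_iSup (fun r : Set.Iic s => MeasurableSpace.comap (X r) inferInstance)
      ⟨s, Set.mem_Iic.2 le_rfl⟩
  rw [integral_mul_eq_of_condExp_ae_eq hle hw
    ((hX.memLp_comp s w).integrable_mul (hX.memLp_comp (s + u) f))
    ((hX.memLp_comp (s + u) f).integrable (by norm_num)) (hX.markov s u f),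
    hX.integral_comp s (φ := fun x => w x * T u f x)
      ((Lp.aestronglyMeasurable w).mul (Lp.aestronglyMeasurable (T u f))), L2.inner_def]
  simp [mul_comm]

/-- Transition operators are contractions: `‖T_t f‖² = E[T_t f (X₀) f (X_t)]`, which is at most
`(‖T_t f‖² + ‖f‖²) / 2` by stationarity. -/
theorem norm_le (hX : IsStationaryMarkovProcess π T P X) (t : ℝ≥0) (f : L2 π) :
    ‖T t f‖ ≤ ‖f‖ := by
  have h : (inner ℝ (T t f) (T t f) : ℝ) ≤ (‖T t f‖ ^ 2 + ‖f‖ ^ 2) / 2 := by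
    rw [← hX.integral_mul_add 0 t, ← hX.integral_sq 0, ← hX.integral_sq (0 + t) f,
      ← integral_add (hX.memLp_comp _ _).integrable_sq (hX.memLp_comp _ _).integrable_sq,
      ← integral_div]
    refine integral_mono ((hX.memLp_comp _ _).integrable_mul (hX.memLp_comp _ _))
      (((hX.memLp_comp _ _).integrable_sq.add (hX.memLp_comp _ _).integrable_sq).div_const 2)
      fun ω => ?_
    have := two_mul_le_add_sq ((T t f) (X 0 ω)) (f (X (0 + t) ω))
    beta_reduce
    linarith
  rw [real_inner_self_eq_norm_sq] at h
  exact le_of_sq_le_sq (by linarith) (norm_nonneg _)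

/-- The generator is dissipative, because the transition operators are contractions. -/
theorem inner_generator_nonpos (hX : IsStationaryMarkovProcess π T P X) (hL : IsGenerator T L)
    {g l : L2 π} (hg : (g, l) ∈ L.graph) : (inner ℝ g l : ℝ) ≤ 0 := by
  refine le_of_tendsto (hL.tendsto_inner hg g) (Eventually.of_forall fun t => ?_)
  refine mul_nonpos_of_nonneg_of_nonpos (by positivity) ?_
  rw [real_inner_self_eq_norm_sq, sub_nonpos, sq]
  exact (real_inner_le_norm _ _).trans
    (mul_le_mul_of_nonneg_left (hX.norm_le t g) (norm_nonneg g))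

theorem integral_mul_eq_abs_sub (hX : IsStationaryMarkovProcess π T P X) (f : L2 π) {r s : ℝ}
    (hr : 0 ≤ r) (hs : 0 ≤ s) :
    ∫ ω, f (X r.toNNReal ω) * f (X s.toNNReal ω) ∂P = inner ℝ f (T |r - s|.toNNReal f) := by
  wlog hrs : r ≤ s generalizing r s
  · rw [abs_sub_comm, ← this hs hr (le_of_not_ge hrs)]
    simp only [mul_comm]
  rw [← hX.integral_mul_add r.toNNReal, ← Real.toNNReal_add hr (abs_nonneg _),
    abs_of_nonpos (by linarith)]
  congr! 6
  ring

variable [IsProbabilityMeasure π]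

/-- The variance of `S_t(f)` is the double time integral of the stationary autocovariance. -/
theorem variance_timeIntegral (hX : IsStationaryMarkovProcess π T P X) (f : L2 π) {t : ℝ}
    (ht : 0 ≤ t) :
    ProbabilityTheory.variance (timeIntegral X f t) P =
      ∫ r in (0 : ℝ)..t, ∫ s in (0 : ℝ)..t,
        inner ℝ (center π f : L2 π) (T |r - s|.toNNReal (center π f)) := by
  set ν : Measure ℝ := volume.restrict (Set.Ioc 0 t) with hν
  set m : ℝ := ∫ x, f x ∂π with hm
  have hS : timeIntegral X f t = fun ω => ∫ r, f (X r.toNNReal ω) ∂ν :=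
    funext fun ω => intervalIntegral.integral_of_le ht
  have hY : Measurable (Function.uncurry fun (r : ℝ) ω => f (X r.toNNReal ω)) :=
    (Lp.stronglyMeasurable f).measurable.comp
      (hX.measurable.comp (by fun_prop : Measurable fun p : ℝ × Ω => (p.1.toNNReal, p.2)))
  -- The one-time means of `|f (X_r)|` are constant in `r`, so almost every path is integrable.
  have hYint : Integrable (Function.uncurry fun (r : ℝ) ω => f (X r.toNNReal ω)) (ν.prod P) := by
    rw [integrable_prod_iff hY.aestronglyMeasurable]
    refine ⟨ae_of_all _ fun r => (hX.memLp_comp r.toNNReal f).integrable (by norm_num), ?_⟩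
    have : ∀ r : ℝ, ∫ ω, ‖f (X r.toNNReal ω)‖ ∂P = ∫ x, ‖f x‖ ∂π := fun r =>
      hX.integral_comp r.toNNReal (φ := fun x => ‖f x‖) (Lp.aestronglyMeasurable f).norm
    simp only [Function.uncurry_apply_pair, this]
    exact integrable_const _
  have hmean : ∫ ω, ∫ r, f (X r.toNNReal ω) ∂ν ∂P = ∫ _r, m ∂ν := by
    rw [← integral_integral_swap hYint]
    exact integral_congr_ae (ae_of_all _ fun r =>
      hX.integral_comp r.toNNReal (φ := fun x => f x) (Lp.aestronglyMeasurable f))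
  have hZae : ∀ r : ℝ, (fun ω => (center π f : L2 π) (X r.toNNReal ω)) =ᵐ[P]
      fun ω => f (X r.toNNReal ω) - m := fun r =>
    (hX.measurePreserving r.toNNReal).quasiMeasurePreserving.ae_eq_comp (coeFn_center_ae_eq f)
  rw [ProbabilityTheory.variance_eq_integral (by
    rw [hS]
    exact hY.stronglyMeasurable.integral_prod_left'.measurable.aemeasurable)]
  rw [hS, hmean]
  have hcentre : ∀ᵐ ω ∂P, ((∫ r, f (X r.toNNReal ω) ∂ν) - ∫ _r, m ∂ν) ^ 2 =
      (∫ r, (f (X r.toNNReal ω) - m) ∂ν) ^ 2 := by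
    filter_upwards [hYint.prod_left_ae] with ω hω
    rw [integral_sub (f := fun r : ℝ => f (X r.toNNReal ω)) hω (integrable_const m)]
  rw [integral_congr_ae hcentre]
  rw [integral_sq_integral (Z := fun r ω => f (X r.toNNReal ω) - m)
    (V := ‖(center π f : L2 π)‖ ^ 2) (hY.sub measurable_const)]
  · rw [intervalIntegral.integral_of_le ht]
    refine setIntegral_congr_fun measurableSet_Ioc fun r hr => ?_
    rw [intervalIntegral.integral_of_le ht]
    refine setIntegral_congr_fun measurableSet_Ioc fun s hs => ?_
    rw [← hX.integral_mul_eq_abs_sub _ hr.1.le hs.1.le]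
    refine integral_congr_ae ?_
    filter_upwards [hZae r, hZae s] with ω h1 h2
    rw [h1, h2]
  · intro r
    exact ((hX.memLp_comp r.toNNReal f).sub (memLp_const m)).integrable_sq
  · intro r
    rw [← hX.integral_sq r.toNNReal]
    refine (integral_congr_ae ?_).le
    filter_upwards [hZae r] with ω h1
    rw [h1]

/-- With `w = f - f̄`, `h = G w` and `k = G h`, the variance of `S_t(f)` is exactly
`2 t ⟨w, h⟩ - 2 ⟨w, k - T_t k⟩`, and the second term is bounded in `t`. -/
theorem hasAsymptoticVariance (hX : IsStationaryMarkovProcess π T P X)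
    (hT : IsMarkovSemigroup π T) (hL : IsGenerator T L) {G : H0 π →L[ℝ] H0 π}
    (hG : IsInverseOnH0 (-L) G) (f : L2 π) : HasAsymptoticVariance P X f (sigmaSq G f) := by
  set w : H0 π := center π f with hw
  set k : L2 π := ↑(G (G w)) with hk
  -- Since `L (G v) = -v`, the time integral of `T_u v` telescopes; used for `v = w` and `v = h`.
  have hprim : ∀ (v : H0 π) {r : ℝ}, 0 ≤ r → ∫ u in (0 : ℝ)..r, inner ℝ (w : L2 π)
      (T u.toNNReal v) = inner ℝ (w : L2 π) (G v : L2 π) -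
        inner ℝ (w : L2 π) (T r.toNNReal (G v)) := by
    intro v r hr
    have := hL.integral_inner hT (mem_graph_of_isInverseOnH0_neg hG v) (w : L2 π) hr
    simp only [map_neg, inner_neg_right, intervalIntegral.integral_neg] at this
    linarith
  have hvar : ∀ t : ℝ, 0 < t → ProbabilityTheory.variance (timeIntegral X f t) P / t =
      sigmaSq G f - 2 * (inner ℝ (w : L2 π) k - inner ℝ (w : L2 π) (T t.toNNReal k)) * t⁻¹ := by
    intro t ht
    rw [hX.variance_timeIntegral f ht.le, integral_integral_abs_sub
      (c := fun u => inner ℝ (w : L2 π) (T u.toNNReal w)) (hT.continuous_inner _ _)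
      (fun r hr => hprim w hr) ht.le, intervalIntegral.integral_sub intervalIntegrable_const
      ((hT.continuous_inner _ _).intervalIntegrable _ _), hprim (G w) ht.le,
      intervalIntegral.integral_const]
    simp only [sigmaSq, ← hw, Submodule.coe_inner, smul_eq_mul, sub_zero, ← hk]
    field_simp
  have hbdd : Tendsto (fun t : ℝ => 2 * (inner ℝ (w : L2 π) k -
      inner ℝ (w : L2 π) (T t.toNNReal k)) * t⁻¹) atTop (𝓝 0) := by
    refine bdd_le_mul_tendsto_zero' (2 * (‖(w : L2 π)‖ * ‖k‖ + ‖(w : L2 π)‖ * ‖k‖))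
      (Eventually.of_forall fun t => ?_) tendsto_inv_atTop_zero
    rw [abs_mul, abs_two]
    refine mul_le_mul_of_nonneg_left ((abs_sub _ _).trans (add_le_add
      (abs_real_inner_le_norm _ _) ((abs_real_inner_le_norm _ _).trans ?_))) zero_le_two
    exact mul_le_mul_of_nonneg_left (hX.norm_le _ _) (norm_nonneg _)
  have := (tendsto_const_nhds (x := sigmaSq G f)).sub hbdd
  rw [sub_zero] at this
  refine this.congr' ?_
  filter_upwards [eventually_gt_atTop 0] with t ht
  exact (hvar t ht).symm

end IsStationaryMarkovProcess

end StationaryProcess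

/-! ### Comparison of the asymptotic variances -/

theorem lemma3p2
    {K Ω₀ Ω : Type*} [MeasurableSpace K] [MeasurableSpace Ω₀] [MeasurableSpace Ω]
    (π : Measure K) [IsProbabilityMeasure π]
    (P₀ : Measure Ω₀) [IsProbabilityMeasure P₀] (P : Measure Ω) [IsProbabilityMeasure P]
    -- the reversible reference process, its semigroup and its generator
    (T₀ : ℝ≥0 → L2 π →L[ℝ] L2 π) (L₀ : L2 π →ₗ.[ℝ] L2 π) (X₀ : ℝ≥0 → Ω₀ → K)
    (hT₀ : IsMarkovSemigroup π T₀)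
    (hrev : ∀ (t : ℝ≥0) (f g : L2 π), inner ℝ (T₀ t f) g = inner ℝ f (T₀ t g))
    (hL₀ : IsGenerator T₀ L₀)
    (hX₀ : IsStationaryMarkovProcess π T₀ P₀ X₀)
    -- the reversible perturbation
    (S : L2 π →ₗ.[ℝ] L2 π) (TS : ℝ≥0 → L2 π →L[ℝ] L2 π)
    (hSdom : L₀.domain ≤ S.domain)
    (hTS : IsMarkovSemigroup π TS) (hLS : IsGenerator TS (L₀ + S))
    (hSsymm : ∀ f g : S.domain, inner ℝ (f : L2 π) (S g) = inner ℝ (S f) (g : L2 π))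
    (hSneg : ∀ f : S.domain, inner ℝ (f : L2 π) (S f) ≤ 0)
    -- the irreversible perturbation
    (A : L2 π →ₗ.[ℝ] L2 π) (T : ℝ≥0 → L2 π →L[ℝ] L2 π) (X : ℝ≥0 → Ω → K)
    (hAdom : (L₀ + S).domain ≤ A.domain)
    (hT : IsMarkovSemigroup π T) (hL : IsGenerator T (L₀ + S + A))
    (hAanti : ∀ f g : A.domain, inner ℝ (f : L2 π) (A g) = -inner ℝ (A f) (g : L2 π))
    (hX : IsStationaryMarkovProcess π T P X)
    -- invertibility on the mean-zero subspace: `G₀ = (-L₀)⁻¹` and `G = (-L)⁻¹`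
    (G₀ G : H0 π →L[ℝ] H0 π)
    (hG₀ : IsInverseOnH0 (-L₀) G₀) (hG : IsInverseOnH0 (-(L₀ + S + A)) G)
    -- boundedness of `(-L₀ - S)^{-1/2} A (-L₀ - S)^{-1/2}`
    (Q : H0 π →L[ℝ] H0 π) (hQ : IsInverseSqrtOnH0 (-(L₀ + S)) Q)
    (hB : IsBoundedConjugate Q A) :
    ∀ f : L2 π,
      HasAsymptoticVariance P₀ X₀ f (sigmaSq G₀ f) ∧
      HasAsymptoticVariance P X f (sigmaSq G f) ∧
      sigmaSq G f ≤ sigmaSq G₀ f := by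
  intro f
  refine ⟨hX₀.hasAsymptoticVariance hT₀ hL₀ hG₀ f, hX.hasAsymptoticVariance hT hL hG f, ?_⟩
  set w : H0 π := center π f with hw
  set h : H0 π := G w with hh
  obtain ⟨y, hy, hyw⟩ := LinearPMap.mem_graph_iff _ |>.1 (mem_graph_of_isInverseOnH0_neg hG w)
  have hyh : (y : L2 π) = h := hy
  -- The domain of a sum is the intersection of the domains.
  have hdA : (h : L2 π) ∈ A.domain := hyh ▸ y.2.2
  have hdS : (h : L2 π) ∈ S.domain := hyh ▸ y.2.1.2
  have hd₀ : (h : L2 π) ∈ L₀.domain := hyh ▸ y.2.1.1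
  have hsum : L₀ ⟨h, hd₀⟩ + S ⟨h, hdS⟩ + A ⟨h, hdA⟩ = -(w : L2 π) := by
    rw [show -(w : L2 π) = (L₀ + S + A) y from hyw.symm,
      show y = ⟨h, ⟨⟨hd₀, hdS⟩, hdA⟩⟩ from Subtype.ext hyh]
    rfl
  have hA : (inner ℝ (h : L2 π) (A ⟨h, hdA⟩) : ℝ) = 0 := by
    have := hAanti ⟨h, hdA⟩ ⟨h, hdA⟩
    rw [real_inner_comm (h : L2 π)] at this
    linarith
  have hS := hSneg ⟨h, hdS⟩
  have hgraph : ((h : L2 π), L₀ ⟨h, hd₀⟩) ∈ L₀.graph := L₀.mem_graph ⟨h, hd₀⟩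
  have hpair : (inner ℝ (h : L2 π) (L₀ ⟨h, hd₀⟩) : ℝ) + inner ℝ (h : L2 π) (S ⟨h, hdS⟩) =
      -inner ℝ (h : L2 π) (w : L2 π) := by
    have := congrArg (fun z : L2 π => (inner ℝ (h : L2 π) z : ℝ)) hsum
    simp only [inner_add_right, inner_neg_right, hA] at this
    linarith
  have hG₀w := mem_graph_of_isInverseOnH0_neg hG₀ w
  -- Dissipativity and symmetry of `L₀`, applied to `G₀ w - h`.
  have hsub := L₀.graph.sub_mem hG₀w hgraph
  have hpos := hX₀.inner_generator_nonpos hL₀ hsub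
  have hsymm := hL₀.inner_symm hrev hgraph hG₀w
  simp only [sigmaSq, ← hw, ← hh, Submodule.coe_inner]
  simp only [inner_sub_left, inner_sub_right, inner_neg_right] at hpos hsymm
  rw [real_inner_comm (h : L2 π), real_inner_comm (G₀ w : L2 π)]
  linarith
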